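/- Let $\mathbb G$ be a countable set, let $A$ be a bounded self-adjoint operator on the complex Hilbert space $\ell^2(\mathbb G)$, and let $\{V(x)\}_{x\in\mathbb G}$ be real random variables on a probability space $(\Omega,\mathcal B,\mathbb P)$. Let $H(\omega)=A+V(\omega)$, where $V(\omega)$ acts as multiplication by $V(\cdot\,;\omega)$ on its maximal domain; this is a (possibly unbounded) self-adjoint operator. For $x,y\in\mathbb G$ and $z\in\mathbb C\setminus\mathbb R$ put $G(x,y;z;\omega)=\langle\delta_x,(H(\omega)-z)^{-1}\delta_y\rangle$, and for $E\in\mathbb R$ put $$\gamma_x(E;\omega)=\lim_{\eta\downarrow 0}\ \sum_{y\in\mathbb G}|G(x,y;E+i\eta;\omega)|^2\ \in[0,\infty].$$ Assume: 1. (K-property) every $F:\Omega\to\mathbb R$ that is, for each finite $\Lambda\subset\mathbb G$, measurable with respect to the $\sigma$-algebra generated by $\{V(y)\}_{y\notin\Lambda}$, is almost surely constant; 2. for each $x\in\mathbb G$, the regular conditional distribution of $V(x)$ given $\{V(y)\}_{y\ne x}$ is almost surely continuous, i.e. it has no atoms. Then for every $x\in\mathbb G$: the limit defining $\gamma_x(E;\omega)$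 exists in $[0,\infty]$ for all $\omega\in\Omega$ and $E\in\mathbb R$; the set $\{\omega:\gamma_x(E;\omega)<\infty\}$ is measurable for every $E\in\mathbb R$; and for Lebesgue-almost every $E\in\mathbb R$, $$\mathbb P\bigl(\gamma_x(E)<\infty\bigr)\in\{0,1\}.$$ -/

import Mathlib

open MeasureTheory ProbabilityTheory Filter Topology
open scoped ENNReal

noncomputable section

namespace SimonWolff

/-- The Hilbert space `ℓ²(G)` of square-summable complex functions on the set `G`. -/
abbrev Ell2 (G : Type*) : Type _ := lp (fun _ : G => ℂ) 2

section Operators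

variable {G : Type*}

open Classical in
/-- The canonical basis vector `δ_x` of `ℓ²(G)`. -/
def delta (x : G) : Ell2 G := lp.single 2 x 1

/-- The (in general unbounded) operator of multiplication by the real function `v`, on its maximal
domain `{ψ ∈ ℓ²(G) | v ψ ∈ ℓ²(G)}`. -/
def potentialOp (v : G → ℝ) : Ell2 G →ₗ.[ℂ] Ell2 G where
  domain :=
    { carrier := {ψ | Memℓp (fun x => (v x : ℂ) * ψ x) 2}
      add_mem' := by
        intro ψ φ hψ hφ
        have h := Memℓp.add hψ hφ
        have he : (fun x => (v x : ℂ) * (ψ + φ) x)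
            = (fun x => (v x : ℂ) * ψ x) + fun x => (v x : ℂ) * φ x := by
          funext x
          simp [mul_add]
        change Memℓp (fun x => (v x : ℂ) * (ψ + φ) x) 2
        rwa [he]
      zero_mem' := by
        have he : (fun x => (v x : ℂ) * (0 : Ell2 G) x) = 0 := by
          funext x
          simp
        change Memℓp (fun x => (v x : ℂ) * (0 : Ell2 G) x) 2
        rw [he]
        exact zero_memℓp
      smul_mem' := by
        intro c ψ hψ
        have h := Memℓp.const_smul hψ c
        have he : (fun x => (v x : ℂ) * (c • ψ) x) = c • fun x => (v x : ℂ) * ψ x := by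
          funext x
          simp [mul_left_comm]
        change Memℓp (fun x => (v x : ℂ) * (c • ψ) x) 2
        rwa [he] }
  toFun :=
    { toFun := fun ψ => ⟨fun x => (v x : ℂ) * (ψ : Ell2 G) x, ψ.2⟩
      map_add' := by
        intro ψ φ
        ext x
        exact mul_add _ _ _
      map_smul' := by
        intro c ψ
        ext x
        exact mul_left_comm _ _ _ }

/-- The operator `H = A + V` on `ℓ²(G)`, where `A` is bounded and `V` is multiplication by `v`;
its domain is that of the multiplication operator. -/
def hamiltonian (A : Ell2 G →L[ℂ] Ell2 G) (v : G → ℝ) : Ell2 G →ₗ.[ℂ] Ell2 G :=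
  (A : Ell2 G →ₗ[ℂ] Ell2 G) +ᵥ potentialOp v

/-- `R` is the bounded inverse of `T - z`: it maps `ℓ²(G)` into the domain of `T`, and it is a
right and a left inverse of `T - z`. -/
def IsResolventAt (T : Ell2 G →ₗ.[ℂ] Ell2 G) (z : ℂ) (R : Ell2 G →L[ℂ] Ell2 G) : Prop :=
  (∀ φ : Ell2 G, ∃ h : R φ ∈ T.domain, T ⟨R φ, h⟩ - z • R φ = φ) ∧
    ∀ ψ : T.domain, R (T ψ - z • (ψ : Ell2 G)) = ψ

open Classical in
/-- The resolvent `(T - z)⁻¹`, as a bounded operator on `ℓ²(G)` (by convention `0` if `z` lies in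
the spectrum of `T`). -/
def resolventOp (T : Ell2 G →ₗ.[ℂ] Ell2 G) (z : ℂ) : Ell2 G →L[ℂ] Ell2 G :=
  if h : ∃ R, IsResolventAt T z R then h.choose else 0

/-- There is at most one resolvent. -/
theorem IsResolventAt.unique {T : Ell2 G →ₗ.[ℂ] Ell2 G} {z : ℂ} {R R' : Ell2 G →L[ℂ] Ell2 G}
    (h : IsResolventAt T z R) (h' : IsResolventAt T z R') : R = R' := by
  ext1 φ
  obtain ⟨hd, he⟩ := h'.1 φ
  have := h.2 ⟨R' φ, hd⟩
  rw [he] at this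
  exact this

theorem IsResolventAt.resolventOp_eq {T : Ell2 G →ₗ.[ℂ] Ell2 G} {z : ℂ}
    {R : Ell2 G →L[ℂ] Ell2 G} (h : IsResolventAt T z R) : resolventOp T z = R := by
  have hex : ∃ R, IsResolventAt T z R := ⟨R, h⟩
  rw [resolventOp, dif_pos hex]
  exact hex.choose_spec.unique h

theorem im_inner_potentialOp (v : G → ℝ) (ψ : (potentialOp v).domain) :
    (inner ℂ (ψ : Ell2 G) (potentialOp v ψ)).im = 0 := by
  have h := Complex.hasSum_im (lp.hasSum_inner (𝕜 := ℂ) (ψ : Ell2 G) (potentialOp v ψ))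
  have h0 : (fun i => (inner ℂ ((ψ : Ell2 G) i) ((potentialOp v ψ : Ell2 G) i)).im)
      = fun _ => 0 := by
    funext i
    have : (potentialOp v ψ : Ell2 G) i = (v i : ℂ) * (ψ : Ell2 G) i := rfl
    rw [this]
    simp
    ring
  rw [h0] at h
  exact h.unique hasSum_zero

/-- The basic lower bound for a self-adjoint operator: `|Im z| ‖ψ‖ ≤ ‖(H - z) ψ‖`. -/
theorem abs_im_mul_norm_le {A : Ell2 G →L[ℂ] Ell2 G} (hA : IsSelfAdjoint A) (v : G → ℝ) (z : ℂ)
    (ψ : (hamiltonian A v).domain) :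
    |z.im| * ‖(ψ : Ell2 G)‖ ≤ ‖hamiltonian A v ψ - z • (ψ : Ell2 G)‖ := by
  have h1 : (inner ℂ (ψ : Ell2 G) (hamiltonian A v ψ - z • (ψ : Ell2 G))).im
      = - (z.im * ‖(ψ : Ell2 G)‖ ^ 2) := by
    have hd : (ψ : Ell2 G) ∈ (potentialOp v).domain := ψ.2
    have hH : hamiltonian A v ψ = A (ψ : Ell2 G) + potentialOp v ⟨ψ, hd⟩ := rfl
    have hVim : (inner ℂ (ψ : Ell2 G) (potentialOp v ⟨ψ, hd⟩)).im = 0 :=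
      im_inner_potentialOp v ⟨ψ, hd⟩
    have hAim : (inner ℂ (ψ : Ell2 G) (A (ψ : Ell2 G))).im = 0 :=
      hA.isSymmetric.im_inner_self_apply (ψ : Ell2 G)
    rw [hH, inner_sub_right, inner_add_right, inner_smul_right, inner_self_eq_norm_sq_to_K,
      Complex.sub_im, Complex.add_im, hAim, hVim]
    simp [← Complex.ofReal_pow]
  have h2 : |z.im| * ‖(ψ : Ell2 G)‖ ^ 2
      ≤ ‖(ψ : Ell2 G)‖ * ‖hamiltonian A v ψ - z • (ψ : Ell2 G)‖ := by
    have h3 := (Complex.abs_im_le_norm _).trans (norm_inner_le_norm (𝕜 := ℂ) (ψ : Ell2 G)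
      (hamiltonian A v ψ - z • (ψ : Ell2 G)))
    rw [h1, abs_neg, abs_mul, abs_of_nonneg (sq_nonneg ‖(ψ : Ell2 G)‖)] at h3
    exact h3
  rcases eq_or_lt_of_le (norm_nonneg (ψ : Ell2 G)) with h0 | h0
  · rw [← h0]
    simp
  · nlinarith

theorem memℓp_mul_of_bounded {w : G → ℂ} {C : ℝ} (hw : ∀ x, ‖w x‖ ≤ C) (ψ : Ell2 G) :
    Memℓp (fun x => w x * ψ x) 2 := by
  refine Memℓp.mono (((lp.memℓp ψ).norm).const_mul C) fun x => ?_
  rw [norm_mul]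
  gcongr
  exact hw x

theorem exists_diagonal (w : G → ℂ) (C : ℝ) (hw : ∀ x, ‖w x‖ ≤ C) :
    ∃ R : Ell2 G →L[ℂ] Ell2 G, ∀ ψ x, R ψ x = w x * ψ x := by
  let L : Ell2 G →ₗ[ℂ] Ell2 G :=
    { toFun := fun ψ => ⟨fun x => w x * ψ x, memℓp_mul_of_bounded hw ψ⟩
      map_add' := by
        intro ψ φ
        ext x
        exact mul_add _ _ _
      map_smul' := by
        intro c ψ
        ext x
        exact mul_left_comm _ _ _ }
  refine ⟨L.mkContinuous |C| fun ψ => ?_, fun ψ x => rfl⟩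
  have h := lp.norm_mono (p := 2) (by simp) (x := L ψ) (y := ((C : ℂ) • ψ : Ell2 G)) fun x => by
    change ‖w x * ψ x‖ ≤ ‖(C : ℂ) * ψ x‖
    rw [norm_mul, norm_mul, Complex.norm_real]
    gcongr
    exact (hw x).trans (le_abs_self C)
  rwa [norm_smul, Complex.norm_real] at h

/-- If `A` is bounded and self-adjoint, then the resolvent of `A + V` exists at every non-real
`z`, so that the convention in `resolventOp` is not used there. -/
theorem isResolventAt_resolventOp {A : Ell2 G →L[ℂ] Ell2 G} (hA : IsSelfAdjoint A) (v : G → ℝ)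
    {z : ℂ} (hz : z.im ≠ 0) :
    IsResolventAt (hamiltonian A v) z (resolventOp (hamiltonian A v) z) := by
  have hz0 : 0 < |z.im| := abs_pos.2 hz
  have hlow : ∀ x, |z.im| ≤ ‖(v x : ℂ) - z‖ := fun x => by
    simpa using Complex.abs_im_le_norm ((v x : ℂ) - z)
  have hne : ∀ x, (v x : ℂ) - z ≠ 0 := fun x => norm_pos_iff.1 (hz0.trans_le (hlow x))
  have hne' : ∀ x, (v x : ℂ) - (starRingEnd ℂ) z ≠ 0 := fun x h => by
    apply hne x
    have := congrArg (starRingEnd ℂ) h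
    simpa using this
  obtain ⟨R₀, hR₀⟩ := exists_diagonal (fun x => ((v x : ℂ) - z)⁻¹) |z.im|⁻¹ fun x => by
    rw [norm_inv]
    exact inv_anti₀ hz0 (hlow x)
  have hdom : ∀ χ, R₀ χ ∈ (potentialOp v).domain := fun χ => by
    have he : (fun x => (v x : ℂ) * R₀ χ x) = ⇑(χ + z • R₀ χ) := by
      funext x
      simp only [lp.coeFn_add, lp.coeFn_smul, Pi.add_apply, Pi.smul_apply, smul_eq_mul, hR₀]
      field_simp [hne x]
      ring
    change Memℓp (fun x => (v x : ℂ) * R₀ χ x) 2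
    rw [he]
    exact lp.memℓp _
  have hV : ∀ χ, potentialOp v ⟨R₀ χ, hdom χ⟩ = χ + z • R₀ χ := fun χ => by
    ext x
    change (v x : ℂ) * R₀ χ x = _
    simp only [lp.coeFn_add, lp.coeFn_smul, Pi.add_apply, Pi.smul_apply, smul_eq_mul, hR₀]
    field_simp [hne x]
    ring
  let S : Ell2 G →L[ℂ] Ell2 G := 1 + A ∘L R₀
  have hS : ∀ χ, hamiltonian A v ⟨R₀ χ, hdom χ⟩ - z • R₀ χ = S χ := fun χ => by
    have : hamiltonian A v ⟨R₀ χ, hdom χ⟩ = A (R₀ χ) + potentialOp v ⟨R₀ χ, hdom χ⟩ := rfl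
    rw [this, hV]
    simp [S]
    abel
  have hanti : ∀ χ, ‖χ‖ ≤ (1 + ‖A‖ * |z.im|⁻¹) * ‖S χ‖ := fun χ => by
    have h1 := abs_im_mul_norm_le hA v z ⟨R₀ χ, hdom χ⟩
    rw [hS] at h1
    have h2 : ‖R₀ χ‖ ≤ |z.im|⁻¹ * ‖S χ‖ := by
      rw [inv_mul_eq_div, le_div_iff₀ hz0, mul_comm]
      exact h1
    have h3 : χ = S χ - A (R₀ χ) := by simp [S]
    calc ‖χ‖ = ‖S χ - A (R₀ χ)‖ := by rw [← h3]
      _ ≤ ‖S χ‖ + ‖A (R₀ χ)‖ := norm_sub_le _ _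
      _ ≤ ‖S χ‖ + ‖A‖ * (|z.im|⁻¹ * ‖S χ‖) := by
        gcongr
        exact (A.le_opNorm _).trans (by gcongr)
      _ = _ := by ring
  have hdense : S.range.topologicalClosure = ⊤ := by
    rw [Submodule.topologicalClosure_eq_top_iff, Submodule.eq_bot_iff]
    intro φ hφ
    have horth : ∀ χ, inner ℂ χ φ + inner ℂ (R₀ χ) (A φ) = 0 := fun χ => by
      have h := (Submodule.mem_orthogonal _ _).1 hφ (S χ) ⟨χ, rfl⟩
      have h2 : inner ℂ (A (R₀ χ)) φ = inner ℂ (R₀ χ) (A φ) := hA.isSymmetric (R₀ χ) φ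
      rw [← h2, ← inner_add_left]
      simpa [S] using h
    have hpt : ∀ x, ((v x : ℂ) - (starRingEnd ℂ) z) * φ x = - A φ x := fun x => by
      classical
      have h := horth (lp.single 2 x 1)
      have hs : R₀ (lp.single 2 x 1) = lp.single 2 x (((v x : ℂ) - z)⁻¹) := by
        ext y
        rw [hR₀]
        by_cases hxy : y = x
        · subst hxy
          simp
        · simp [hxy]
      rw [hs, lp.inner_single_left, lp.inner_single_left] at h
      simp only [RCLike.inner_apply, map_one, mul_one, map_inv₀, map_sub, Complex.conj_ofReal] at h
      have h' := hne' x
      field_simp at h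
      linear_combination h
    have hφd : φ ∈ (potentialOp v).domain := by
      have he : (fun x => (v x : ℂ) * φ x) = ⇑((starRingEnd ℂ) z • φ - A φ) := by
        funext x
        simp only [lp.coeFn_sub, lp.coeFn_smul, Pi.sub_apply, Pi.smul_apply, smul_eq_mul]
        linear_combination hpt x
      change Memℓp (fun x => (v x : ℂ) * φ x) 2
      rw [he]
      exact lp.memℓp _
    have hz' : hamiltonian A v ⟨φ, hφd⟩ - (starRingEnd ℂ) z • φ = 0 := by
      ext x
      change A φ x + (v x : ℂ) * φ x - (starRingEnd ℂ) z * φ x = 0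
      linear_combination hpt x
    have h := abs_im_mul_norm_le hA v ((starRingEnd ℂ) z) ⟨φ, hφd⟩
    rw [hz', norm_zero, Complex.conj_im, abs_neg] at h
    have hn : ‖φ‖ ≤ 0 := nonpos_of_mul_nonpos_right h hz0
    exact norm_le_zero_iff.1 hn
  have hpos : 0 ≤ 1 + ‖A‖ * |z.im|⁻¹ := by positivity
  have hbij : Function.Bijective S :=
    (ContinuousLinearMap.bijective_iff_dense_range_and_antilipschitz S).2
      ⟨hdense, ⟨1 + ‖A‖ * |z.im|⁻¹, hpos⟩, S.antilipschitz_of_bound fun χ => hanti χ⟩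
  let e := ContinuousLinearEquiv.ofBijective S (LinearMap.ker_eq_bot.2 hbij.1)
    (LinearMap.range_eq_top.2 hbij.2)
  let R : Ell2 G →L[ℂ] Ell2 G := R₀ ∘L (e.symm : Ell2 G →L[ℂ] Ell2 G)
  have hright : ∀ φ, hamiltonian A v ⟨R φ, hdom (e.symm φ)⟩ - z • R φ = φ := fun φ =>
    (hS (e.symm φ)).trans (e.apply_symm_apply φ)
  have hR : IsResolventAt (hamiltonian A v) z R := by
    refine ⟨fun φ => ⟨hdom _, hright φ⟩, fun ψ => ?_⟩
    have hd : R (hamiltonian A v ψ - z • (ψ : Ell2 G)) ∈ (hamiltonian A v).domain := hdom _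
    have h1 := hright (hamiltonian A v ψ - z • (ψ : Ell2 G))
    have h2 := abs_im_mul_norm_le hA v z
      (⟨R (hamiltonian A v ψ - z • (ψ : Ell2 G)), hd⟩ - ψ)
    have h3 : hamiltonian A v (⟨R (hamiltonian A v ψ - z • (ψ : Ell2 G)), hd⟩ - ψ)
        - z • ((⟨R (hamiltonian A v ψ - z • (ψ : Ell2 G)), hd⟩ - ψ :
          (hamiltonian A v).domain) : Ell2 G) = 0 := by
      rw [LinearPMap.map_sub, Submodule.coe_sub, smul_sub, sub_sub_sub_comm, h1, sub_self]
    rw [h3, norm_zero] at h2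
    have hn := norm_le_zero_iff.1 (nonpos_of_mul_nonpos_right h2 hz0)
    exact sub_eq_zero.1 hn
  rw [hR.resolventOp_eq]
  exact hR

/-- The Green function `G(x, y; z) = ⟨δ_x, (A + V - z)⁻¹ δ_y⟩`. -/
def green (A : Ell2 G →L[ℂ] Ell2 G) (v : G → ℝ) (x y : G) (z : ℂ) : ℂ :=
  inner ℂ (delta x) (resolventOp (hamiltonian A v) z (delta y))

/-- The sum `∑_y |G(x, y; E + i η)|²`, as an element of `[0, ∞]`. -/
def greenSqSum (A : Ell2 G →L[ℂ] Ell2 G) (v : G → ℝ) (x : G) (E η : ℝ) : ℝ≥0∞ :=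
  ∑' y, ‖green A v x y ((E : ℂ) + (η : ℂ) * Complex.I)‖ₑ ^ 2

/-- `γ_x(E) = lim_{η ↓ 0} ∑_y |G(x, y; E + i η)|²`, as an element of `[0, ∞]`. -/
def gammaFn (A : Ell2 G →L[ℂ] Ell2 G) (v : G → ℝ) (x : G) (E : ℝ) : ℝ≥0∞ :=
  limUnder (𝓝[>] (0 : ℝ)) fun η => greenSqSum A v x E η

end Operators

section Probability

variable {G Ω : Type*}

/-- The σ-algebra on `Ω` generated by the random variables `V y`, `y ∈ Λ`. -/
abbrev sigmaOn (V : G → Ω → ℝ) (Λ : Set G) : MeasurableSpace Ω :=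
  ⨆ y ∈ Λ, MeasurableSpace.comap (V y) inferInstance

/-- `F` is measurable at infinity: for each finite `Λ`, it is measurable with respect to the
σ-algebra generated by the variables `V y`, `y ∉ Λ`. -/
def MeasurableAtInfinity (V : G → Ω → ℝ) (F : Ω → ℝ) : Prop :=
  ∀ Λ : Set G, Λ.Finite → Measurable[sigmaOn V Λᶜ] F

variable [MeasurableSpace Ω]

/-- The K-property: every random variable which is measurable at infinity is almost surely
constant. -/
def HasKProperty (V : G → Ω → ℝ) (P : Measure Ω) : Prop :=
  ∀ F : Ω → ℝ, MeasurableAtInfinity V F → ∃ c : ℝ, ∀ᵐ ω ∂P, F ω = c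

/-- For each `x`, the regular conditional distribution of `V x` conditioned on
`(V y)_{y ≠ x}` is almost surely continuous, i.e. has no atoms. -/
def HasContinuousConditionalLaws (V : G → Ω → ℝ) (P : Measure Ω) [IsFiniteMeasure P] : Prop :=
  ∀ x : G, ∀ᵐ ω ∂P, ∀ t : ℝ,
    condDistrib (V x) (fun ω' (y : {y : G // y ≠ x}) => V y ω') P (fun y => V y ω) {t} = 0

end Probability

end SimonWolff

end

/-! The sum defining `greenSqSum` is the squared norm of the solution `ψ` of `(A + V - E + iη) ψ =
δ_x`. It increases as `η ↓ 0`, and by weak compactness it stays bounded exactly when `δ_x` lies in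
the range of `A + V - E` (`gammaFn_lt_top_iff`). Fix `E` and let `D` be the set of potentials with
this property. Changing one value of the potential is a rank-one perturbation, so on each coordinate
line either `D` or its complement has at most one point (`lineTrivial_exists_solves`). As the
conditional laws have no atoms, `D` almost surely agrees with the majority vote over three fixed
values of a coordinate. That vote is measurable, no longer depends on the coordinate, and is again
trivial on lines (`LineTrivial.majority`). Voting successively over an enumeration of `G` and taking
the limsup gives an event exactly, not just up to null sets, measurable at infinity and almost
surely equal to `D`. The K-property applies to it. This works for every `E`. -/

namespace SimonWolff

/-! ### The equation `(A + u - z) ψ = φ` read site by site. -/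

section PointwiseEquation

variable {G : Type*}

/-- `ψ` solves `(A + u - z) ψ = φ` at every site. -/
def Solves (A : Ell2 G →L[ℂ] Ell2 G) (u : G → ℝ) (z : ℂ) (φ ψ : Ell2 G) : Prop :=
  ∀ y, A ψ y + (u y : ℂ) * ψ y - z * ψ y = φ y

theorem inner_delta_left (x : G) (ψ : Ell2 G) : inner ℂ (delta x) ψ = ψ x := by
  classical
  have : delta x = (lp.single 2 x (1 : ℂ) : Ell2 G) := by unfold delta; congr
  rw [this, lp.inner_single_left]
  simp

theorem delta_apply_self (x : G) : delta x x = 1 := by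
  classical
  simp [delta]

theorem delta_apply_of_ne {x y : G} (h : y ≠ x) : delta x y = 0 := by
  classical
  simp [delta, h]

theorem Solves.sub {A : Ell2 G →L[ℂ] Ell2 G} {u : G → ℝ} {z z' : ℂ} {φ φ' ψ ψ' : Ell2 G}
    (h : Solves A u z φ ψ) (h' : Solves A u z' φ' ψ') (c : ℂ) :
    Solves A u c (φ - φ' + (z - c) • ψ - (z' - c) • ψ') (ψ - ψ') := by
  intro y
  have h1 := h y
  have h2 := h' y
  simp only [map_sub, lp.coeFn_sub, lp.coeFn_add, lp.coeFn_smul, Pi.sub_apply, Pi.add_apply,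
    Pi.smul_apply, smul_eq_mul]
  linear_combination h1 - h2

theorem Solves.add_smul {A : Ell2 G →L[ℂ] Ell2 G} {u : G → ℝ} {z : ℂ} {φ φ' ψ ψ' : Ell2 G}
    (h : Solves A u z φ ψ) (h' : Solves A u z φ' ψ') (c : ℂ) :
    Solves A u z (φ + c • φ') (ψ + c • ψ') := by
  intro y
  have h1 := h y
  have h2 := h' y
  simp only [map_add, map_smul, lp.coeFn_add, lp.coeFn_smul, Pi.add_apply,
    Pi.smul_apply, smul_eq_mul]
  linear_combination h1 + c * h2

theorem Solves.smul {A : Ell2 G →L[ℂ] Ell2 G} {u : G → ℝ} {z : ℂ} {φ ψ : Ell2 G}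
    (h : Solves A u z φ ψ) (c : ℂ) : Solves A u z (c • φ) (c • ψ) := by
  intro y
  have h1 := h y
  simp only [map_smul, lp.coeFn_smul, Pi.smul_apply, smul_eq_mul]
  linear_combination c * h1

-- A change of the potential at one site is a rank-one term, which can be moved to the right-hand
-- side.
open Classical in
theorem Solves.update {A : Ell2 G →L[ℂ] Ell2 G} {u : G → ℝ} {z : ℂ} {φ ψ : Ell2 G}
    (h : Solves A u z φ ψ) (y : G) (t : ℝ) :
    Solves A (Function.update u y t) z (φ + (((t : ℂ) - u y) * ψ y) • delta y) ψ := by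
  intro x
  have h1 := h x
  simp only [lp.coeFn_add, lp.coeFn_smul, Pi.add_apply, Pi.smul_apply, smul_eq_mul]
  by_cases hx : x = y
  · subst hx
    rw [Function.update_self, delta_apply_self]
    linear_combination h1
  · rw [Function.update_of_ne hx, delta_apply_of_ne hx]
    linear_combination h1

/-- The equation itself forces `u ψ` into `ℓ²`, so `ψ` lies in the maximal domain, where the
quadratic form of `A + u` is real. -/
theorem Solves.im_inner_eq_zero {A : Ell2 G →L[ℂ] Ell2 G} (hA : IsSelfAdjoint A) {u : G → ℝ}
    {φ ψ : Ell2 G} (h : Solves A u 0 φ ψ) : (inner ℂ ψ φ).im = 0 := by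
  have hAim : (inner ℂ ψ (A ψ)).im = 0 := hA.isSymmetric.im_inner_self_apply ψ
  have hd : ψ ∈ (potentialOp u).domain := by
    change Memℓp (fun x => (u x : ℂ) * ψ x) 2
    have he : (fun x => (u x : ℂ) * ψ x) = ⇑(φ - A ψ) := by
      funext x
      simp only [lp.coeFn_sub, Pi.sub_apply]
      linear_combination h x
    rw [he]
    exact lp.memℓp _
  have he : potentialOp u ⟨ψ, hd⟩ = φ - A ψ := by
    ext x
    change (u x : ℂ) * ψ x = φ x - A ψ x
    linear_combination h x
  have h0 := im_inner_potentialOp u ⟨ψ, hd⟩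
  rw [he, inner_sub_right, Complex.sub_im, hAim, sub_zero] at h0
  exact h0

/-- Solutions at energies with the same real part are the smaller, the larger the imaginary part
is in modulus. -/
theorem Solves.norm_le_norm {A : Ell2 G →L[ℂ] Ell2 G} (hA : IsSelfAdjoint A) {u : G → ℝ}
    {E η η' : ℝ} (hη' : 0 ≤ η') (hη : 0 < η) (hle : η' ≤ η) {φ ψ ψ' : Ell2 G}
    (h : Solves A u (E - η * Complex.I) φ ψ) (h' : Solves A u (E - η' * Complex.I) φ ψ') :
    ‖ψ‖ ≤ ‖ψ'‖ := by
  have hs : Solves A (fun y => u y - E) 0 (-(Complex.I • ((η : ℂ) • ψ - (η' : ℂ) • ψ')))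
      (ψ - ψ') := by
    intro y
    have h1 := h.sub h' E y
    simp only [map_sub, lp.coeFn_sub, lp.coeFn_add, lp.coeFn_smul, lp.coeFn_neg, Pi.sub_apply,
      Pi.add_apply, Pi.smul_apply, Pi.neg_apply, smul_eq_mul, Complex.ofReal_sub] at h1 ⊢
    linear_combination h1
  have h0 := hs.im_inner_eq_zero hA
  have hre : (inner ℂ ψ' ψ).re = (inner ℂ ψ ψ').re := inner_re_symm (𝕜 := ℂ) ψ' ψ
  have hself : ∀ χ : Ell2 G, (inner ℂ χ χ).re = ‖χ‖ ^ 2 := fun χ =>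
    inner_self_eq_norm_sq (𝕜 := ℂ) χ
  simp only [inner_neg_right, inner_smul_right, inner_sub_right, inner_sub_left, Complex.neg_im,
    Complex.mul_im, Complex.I_re, Complex.I_im, Complex.sub_re, Complex.mul_re, Complex.ofReal_re,
    Complex.ofReal_im, hre, hself] at h0
  have hcs : (inner ℂ ψ ψ').re ≤ ‖ψ‖ * ‖ψ'‖ := re_inner_le_norm (𝕜 := ℂ) ψ ψ'
  by_contra! hlt
  -- Reality of the form gives `η‖ψ‖² - (η + η') Re⟨ψ, ψ'⟩ + η'‖ψ'‖² = 0`; Cauchy–Schwarz bounds the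
  -- middle term.
  have h1 : (η * ‖ψ‖ - η' * ‖ψ'‖) * (‖ψ‖ - ‖ψ'‖) ≤ 0 := by
    nlinarith [mul_le_mul_of_nonneg_left hcs (add_nonneg hη.le hη')]
  have h2 : 0 < η * ‖ψ‖ - η' * ‖ψ'‖ := by
    nlinarith [norm_nonneg ψ', mul_lt_mul_of_pos_left hlt hη]
  nlinarith [mul_pos h2 (sub_pos.2 hlt)]

theorem Solves.abs_im_mul_norm_le {A : Ell2 G →L[ℂ] Ell2 G} (hA : IsSelfAdjoint A) {u : G → ℝ}
    {z : ℂ} {φ ψ : Ell2 G} (h : Solves A u z φ ψ) : |z.im| * ‖ψ‖ ≤ ‖φ‖ := by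
  have hd : ψ ∈ (hamiltonian A u).domain := by
    change Memℓp (fun x => (u x : ℂ) * ψ x) 2
    have he : (fun x => (u x : ℂ) * ψ x) = ⇑(φ - A ψ + z • ψ) := by
      funext x
      simp only [lp.coeFn_sub, lp.coeFn_add, lp.coeFn_smul, Pi.sub_apply, Pi.add_apply,
        Pi.smul_apply, smul_eq_mul]
      linear_combination h x
    rw [he]
    exact lp.memℓp _
  have he : hamiltonian A u ⟨ψ, hd⟩ - z • ψ = φ := by
    ext x
    exact h x
  have h0 := SimonWolff.abs_im_mul_norm_le hA u z ⟨ψ, hd⟩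
  rwa [he] at h0

theorem Solves.unique {A : Ell2 G →L[ℂ] Ell2 G} (hA : IsSelfAdjoint A) {u : G → ℝ}
    {z : ℂ} (hz : z.im ≠ 0) {φ ψ ψ' : Ell2 G} (h : Solves A u z φ ψ) (h' : Solves A u z φ ψ') :
    ψ = ψ' := by
  have h0 := (h.sub h' z).abs_im_mul_norm_le hA
  rw [sub_self, sub_self, zero_smul, zero_smul, add_zero, sub_zero, norm_zero] at h0
  exact sub_eq_zero.1 (norm_le_zero_iff.1 (nonpos_of_mul_nonpos_right h0 (abs_pos.2 hz)))

theorem solves_resolventOp {A : Ell2 G →L[ℂ] Ell2 G} (hA : IsSelfAdjoint A) (u : G → ℝ)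
    {z : ℂ} (hz : z.im ≠ 0) (φ : Ell2 G) :
    Solves A u z φ (resolventOp (hamiltonian A u) z φ) := by
  obtain ⟨hd, he⟩ := (isResolventAt_resolventOp hA u hz).1 φ
  intro y
  exact congrArg (fun χ : Ell2 G => χ y) he

theorem delta_mem_domain (A : Ell2 G →L[ℂ] Ell2 G) (u : G → ℝ) (y : G) :
    delta y ∈ (hamiltonian A u).domain := by
  change Memℓp (fun x => (u x : ℂ) * delta y x) 2
  have he : (fun x => (u x : ℂ) * delta y x) = ⇑((u y : ℂ) • delta y : Ell2 G) := by
    funext x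
    by_cases hx : x = y
    · subst hx
      simp only [lp.coeFn_smul, Pi.smul_apply, smul_eq_mul]
    · simp only [lp.coeFn_smul, Pi.smul_apply, smul_eq_mul, delta_apply_of_ne hx, mul_zero]
  rw [he]
  exact lp.memℓp _

/-- Testing against `δ_y`, which always lies in the domain, turns the left-inverse property of the
resolvent into the equation for its adjoint at site `y`. -/
theorem solves_adjoint_resolventOp {A : Ell2 G →L[ℂ] Ell2 G} (hA : IsSelfAdjoint A) (u : G → ℝ)
    {z : ℂ} (hz : z.im ≠ 0) (φ : Ell2 G) :
    Solves A u ((starRingEnd ℂ) z) φ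
      (ContinuousLinearMap.adjoint (resolventOp (hamiltonian A u) z) φ) := by
  intro y
  set χ := ContinuousLinearMap.adjoint (resolventOp (hamiltonian A u) z) φ with hχ
  have hl := (isResolventAt_resolventOp hA u hz).2 ⟨delta y, delta_mem_domain A u y⟩
  have he : hamiltonian A u ⟨delta y, delta_mem_domain A u y⟩ - z • delta y
      = A (delta y) + ((u y : ℂ) - z) • delta y := by
    ext x
    change A (delta y) x + (u x : ℂ) * delta y x - z * delta y x
      = A (delta y) x + ((u y : ℂ) - z) * delta y x
    by_cases hx : x = y
    · subst hx
      ring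
    · rw [delta_apply_of_ne hx]
      ring
  rw [he] at hl
  have h1 : inner ℂ (A (delta y) + ((u y : ℂ) - z) • delta y) χ = φ y := by
    rw [hχ, ContinuousLinearMap.adjoint_inner_right, hl, inner_delta_left]
  have h2 : inner ℂ (A (delta y)) χ = inner ℂ (delta y) (A χ) := hA.isSymmetric (delta y) χ
  rw [inner_add_left, inner_smul_left, h2, inner_delta_left, inner_delta_left, map_sub,
    Complex.conj_ofReal] at h1
  linear_combination h1

/-- A bounded family in a Hilbert space converges weakly along every ultrafilter. -/
theorem exists_weak_limit {ι F : Type*} [NormedAddCommGroup F] [InnerProductSpace ℂ F]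
    [CompleteSpace F] (l : Ultrafilter ι) {ψ : ι → F} {C : ℝ} (h : ∀ᶠ i in (l : Filter ι), ‖ψ i‖ ≤ C) :
    ∃ χ : F, ∀ φ, Tendsto (fun i => inner ℂ φ (ψ i)) l (𝓝 (inner ℂ φ χ)) := by
  let T : ι → WeakDual ℂ F := fun i => StrongDual.toWeakDual (InnerProductSpace.toDual ℂ F (ψ i))
  -- Banach–Alaoglu, transported through the Riesz isomorphism.
  have hK := WeakDual.isCompact_closedBall (0 : StrongDual ℂ F) C
  have hmem : (l.map T : Filter (WeakDual ℂ F))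
      ≤ 𝓟 (WeakDual.toStrongDual ⁻¹' Metric.closedBall (0 : StrongDual ℂ F) C) := by
    rw [le_principal_iff, Ultrafilter.coe_map, mem_map]
    filter_upwards [h] with i hi
    change InnerProductSpace.toDual ℂ F (ψ i) ∈ Metric.closedBall (0 : StrongDual ℂ F) C
    simpa using hi
  obtain ⟨f, -, hf⟩ := hK.ultrafilter_le_nhds (l.map T) hmem
  refine ⟨(InnerProductSpace.toDual ℂ F).symm (WeakDual.toStrongDual f), fun φ => ?_⟩
  have h1 : Tendsto (fun i => T i φ) l (𝓝 (f φ)) :=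
    ((WeakDual.eval_continuous φ).tendsto f).comp hf
  have h2 := (Complex.continuous_conj.tendsto _).comp h1
  have h3 : inner ℂ φ ((InnerProductSpace.toDual ℂ F).symm (WeakDual.toStrongDual f))
      = (starRingEnd ℂ) (f φ) := by
    rw [← inner_conj_symm, InnerProductSpace.toDual_symm_apply]
    rfl
  rw [h3]
  refine h2.congr fun i => ?_
  change (starRingEnd ℂ) (inner ℂ (ψ i) φ) = _
  exact inner_conj_symm _ _

/-- By symmetry `(A ψ)(y) = ⟨A δ_y, ψ⟩`, so every term of the equation at a fixed site is weakly
continuous. The potentials need only converge pointwise. -/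
theorem exists_solves_of_tendsto {ι : Type*} {A : Ell2 G →L[ℂ] Ell2 G} (hA : IsSelfAdjoint A)
    (l : Ultrafilter ι) {u : ι → G → ℝ} {u₀ : G → ℝ} (hu : ∀ y, Tendsto (fun i => u i y) l (𝓝 (u₀ y)))
    {z : ι → ℂ} {z₀ : ℂ} (hz : Tendsto z l (𝓝 z₀)) {φ : Ell2 G} {ψ : ι → Ell2 G} {C : ℝ}
    (hs : ∀ᶠ i in (l : Filter ι), Solves A (u i) (z i) φ (ψ i))
    (hC : ∀ᶠ i in (l : Filter ι), ‖ψ i‖ ≤ C) :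
    ∃ χ, Solves A u₀ z₀ φ χ ∧ ∀ y, Tendsto (fun i => ψ i y) l (𝓝 (χ y)) := by
  obtain ⟨χ, hχ⟩ := exists_weak_limit l hC
  have hpt : ∀ y, Tendsto (fun i => ψ i y) l (𝓝 (χ y)) := fun y => by
    simpa only [inner_delta_left] using hχ (delta y)
  have hApt : ∀ y, Tendsto (fun i => A (ψ i) y) l (𝓝 (A χ y)) := fun y => by
    have h1 : ∀ ξ, inner ℂ (A (delta y)) ξ = A ξ y := fun ξ => by
      rw [← inner_delta_left y (A ξ)]
      exact hA.isSymmetric (delta y) ξ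
    simpa only [h1] using hχ (A (delta y))
  refine ⟨χ, fun y => ?_, hpt⟩
  have huc : Tendsto (fun i => (u i y : ℂ)) l (𝓝 (u₀ y)) :=
    (Complex.continuous_ofReal.tendsto _).comp (hu y)
  have hlim := ((hApt y).add (huc.mul (hpt y))).sub (hz.mul (hpt y))
  refine tendsto_nhds_unique hlim (tendsto_const_nhds.congr' ?_)
  filter_upwards [hs] with i hi
  exact (hi y).symm

end PointwiseEquation

/-! ### Existence, finiteness and measurability of `γ_x(E)`. -/

section Gamma

variable {G : Type*}

/-- The resolvent bound is uniform in the potential, and any weak limit of solutions solves the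
limiting equation, whose solution is unique. -/
theorem continuous_green {A : Ell2 G →L[ℂ] Ell2 G} (hA : IsSelfAdjoint A) (x y : G) {z : ℂ}
    (hz : z.im ≠ 0) : Continuous fun v : G → ℝ => green A v x y z := by
  rw [continuous_iff_continuousAt]
  intro v
  rw [ContinuousAt, tendsto_iff_ultrafilter]
  intro l hl
  have hb : ∀ w : G → ℝ, ‖resolventOp (hamiltonian A w) z (delta y)‖ ≤ |z.im|⁻¹ * ‖delta y‖ := by
    intro w
    rw [inv_mul_eq_div, le_div_iff₀' (abs_pos.2 hz)]
    exact (solves_resolventOp hA w hz (delta y)).abs_im_mul_norm_le hA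
  obtain ⟨χ, hs, hχ⟩ := exists_solves_of_tendsto hA l (u := fun w : G → ℝ => w) (u₀ := v)
    (fun i => ((continuous_apply i).tendsto v).mono_left hl) (tendsto_const_nhds (x := z))
    (Eventually.of_forall fun w => solves_resolventOp hA w hz (delta y))
    (Eventually.of_forall hb)
  rw [hs.unique hA hz (solves_resolventOp hA v hz (delta y))] at hχ
  simpa only [green, inner_delta_left] using hχ x

theorem tsum_enorm_sq_eq (ψ : Ell2 G) : ∑' y, ‖ψ y‖ₑ ^ 2 = ENNReal.ofReal (‖ψ‖ ^ 2) := by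
  have h := lp.hasSum_norm (p := 2) (by simp) ψ
  simp only [ENNReal.toReal_ofNat, Real.rpow_ofNat] at h
  rw [← h.tsum_eq, ENNReal.ofReal_tsum_of_nonneg (fun _ => by positivity) h.summable]
  refine tsum_congr fun y => ?_
  rw [ENNReal.ofReal_pow (norm_nonneg _), ofReal_norm]

/-- The sum runs over a row of the resolvent, hence over the entries of its adjoint applied to
`δ_x`; this is why the energy is conjugated. -/
theorem exists_solves_greenSqSum_eq {A : Ell2 G →L[ℂ] Ell2 G} (hA : IsSelfAdjoint A) (v : G → ℝ)
    (x : G) (E : ℝ) {η : ℝ} (hη : 0 < η) :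
    ∃ ψ, Solves A v (E - η * Complex.I) (delta x) ψ ∧
      greenSqSum A v x E η = ENNReal.ofReal (‖ψ‖ ^ 2) := by
  have hz : ((E : ℂ) + (η : ℂ) * Complex.I).im ≠ 0 := by simpa using hη.ne'
  have h := solves_adjoint_resolventOp hA v hz (delta x)
  have hc : (starRingEnd ℂ) ((E : ℂ) + (η : ℂ) * Complex.I) = E - η * Complex.I := by
    simp [sub_eq_add_neg]
  rw [hc] at h
  refine ⟨_, h, ?_⟩
  rw [← tsum_enorm_sq_eq, greenSqSum]
  refine tsum_congr fun y => ?_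
  congr 1
  rw [green, ← inner_delta_left y, ContinuousLinearMap.adjoint_inner_right, ← inner_conj_symm,
    enorm_eq_nnnorm, enorm_eq_nnnorm, RCLike.nnnorm_conj]

theorem antitoneOn_greenSqSum {A : Ell2 G →L[ℂ] Ell2 G} (hA : IsSelfAdjoint A) (v : G → ℝ)
    (x : G) (E : ℝ) : AntitoneOn (greenSqSum A v x E) (Set.Ioi 0) := by
  intro η' hη' η hη hle
  obtain ⟨ψ, hψ, he⟩ := exists_solves_greenSqSum_eq hA v x E hη
  obtain ⟨ψ', hψ', he'⟩ := exists_solves_greenSqSum_eq hA v x E hη'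
  rw [he, he']
  have := hψ.norm_le_norm hA (Set.mem_Ioi.1 hη').le hη hle hψ'
  gcongr

theorem tendsto_greenSqSum {A : Ell2 G →L[ℂ] Ell2 G} (hA : IsSelfAdjoint A) (v : G → ℝ)
    (x : G) (E : ℝ) :
    Tendsto (greenSqSum A v x E) (𝓝[>] 0) (𝓝 (gammaFn A v x E)) := by
  have h := (antitoneOn_greenSqSum hA v x E).dual_right.tendsto_nhdsGT (OrderBot.bddBelow _)
  exact tendsto_nhds_limUnder ⟨_, h⟩

theorem greenSqSum_le_gammaFn {A : Ell2 G →L[ℂ] Ell2 G} (hA : IsSelfAdjoint A) (v : G → ℝ)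
    (x : G) (E : ℝ) {η : ℝ} (hη : 0 < η) : greenSqSum A v x E η ≤ gammaFn A v x E := by
  refine ge_of_tendsto (tendsto_greenSqSum hA v x E) ?_
  filter_upwards [Ioo_mem_nhdsGT hη] with η' hη'
  exact antitoneOn_greenSqSum hA v x E hη'.1 hη hη'.2.le

/-- `γ_x(E) < ∞` if and only if `δ_x` lies in the range of `A + V - E`. -/
theorem gammaFn_lt_top_iff {A : Ell2 G →L[ℂ] Ell2 G} (hA : IsSelfAdjoint A) (v : G → ℝ)
    (x : G) (E : ℝ) : gammaFn A v x E < ∞ ↔ ∃ ψ, Solves A v E (delta x) ψ := by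
  constructor
  · intro h
    choose! ψ hψ he using fun η (hη : 0 < η) => exists_solves_greenSqSum_eq hA v x E hη
    -- A bound uniform in `η` allows a weak limit along an ultrafilter finer than `η ↓ 0`.
    let l := Ultrafilter.of (𝓝[>] (0 : ℝ))
    have hl : (l : Filter ℝ) ≤ 𝓝[>] 0 := Ultrafilter.of_le _
    have hpos : ∀ᶠ η in (l : Filter ℝ), 0 < η := hl self_mem_nhdsWithin
    have hz : Tendsto (fun η : ℝ => (E : ℂ) - η * Complex.I) l (𝓝 E) := by
      have hc : Continuous fun η : ℝ => (E : ℂ) - η * Complex.I := by fun_prop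
      have := hc.tendsto 0
      simp only [Complex.ofReal_zero, zero_mul, sub_zero] at this
      exact this.mono_left (hl.trans nhdsWithin_le_nhds)
    obtain ⟨χ, hχ, -⟩ := exists_solves_of_tendsto hA l (u := fun _ => v)
      (fun _ => tendsto_const_nhds) hz (hpos.mono fun η hη => hψ η hη)
      (C := √(gammaFn A v x E).toReal) (hpos.mono fun η hη => by
        apply Real.le_sqrt_of_sq_le
        rw [← ENNReal.ofReal_le_iff_le_toReal h.ne, ← he η hη]
        exact greenSqSum_le_gammaFn hA v x E hη)
    exact ⟨χ, hχ⟩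
  · rintro ⟨ψ, hψ⟩
    refine lt_of_le_of_lt (b := ENNReal.ofReal (‖ψ‖ ^ 2)) ?_ ENNReal.ofReal_lt_top
    refine le_of_tendsto (tendsto_greenSqSum hA v x E) ?_
    filter_upwards [self_mem_nhdsWithin] with η hη
    obtain ⟨ψ', hψ', he⟩ := exists_solves_greenSqSum_eq hA v x E hη
    rw [he]
    -- The comparison is used with `η' = 0`: a solution at the real energy dominates all the others.
    have := hψ'.norm_le_norm hA le_rfl hη (Set.mem_Ioi.1 hη).le (ψ' := ψ) (by simpa using hψ)
    gcongr

theorem measurable_gammaFn [Countable G] {A : Ell2 G →L[ℂ] Ell2 G} (hA : IsSelfAdjoint A) (x : G)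
    (E : ℝ) : Measurable fun v : G → ℝ => gammaFn A v x E := by
  have hm : ∀ n : ℕ, Measurable fun v : G → ℝ => greenSqSum A v x E (1 / ((n : ℝ) + 1)) := by
    intro n
    have hn : 1 / ((n : ℝ) + 1) ≠ 0 := by positivity
    have hz : ((E : ℂ) + ((1 / ((n : ℝ) + 1) : ℝ) : ℂ) * Complex.I).im ≠ 0 := by
      rwa [Complex.add_im, Complex.ofReal_im, zero_add, Complex.im_ofReal_mul, Complex.I_im,
        mul_one]
    unfold greenSqSum
    exact Measurable.tsum fun y => (continuous_green hA x y hz).measurable.enorm.pow_const 2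
  refine measurable_of_tendsto_metrizable hm (tendsto_pi_nhds.2 fun v => ?_)
  refine (tendsto_greenSqSum hA v x E).comp ?_
  exact tendsto_nhdsWithin_iff.2 ⟨tendsto_one_div_add_atTop_nhds_zero_nat,
    Eventually.of_forall fun n => by simp only [Set.mem_Ioi]; positivity⟩

end Gamma

end SimonWolff

namespace SimonWolff

/-! ### Majority votes on coordinate lines. -/

section Majority

variable {G : Type*}

open Classical in
/-- Along every coordinate line, `D` or its complement contains at most one point. -/
def LineTrivial (D : Set (G → ℝ)) : Prop :=
  ∀ (y : G) (v : G → ℝ), {t | Function.update v y t ∈ D}.Subsingleton ∨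
    {t | Function.update v y t ∉ D}.Subsingleton

open Classical in
/-- The points for which `D` contains at least two of the three points obtained by setting the
coordinate `y` to `0`, `1` and `2`. -/
def majority (y : G) (D : Set (G → ℝ)) : Set (G → ℝ) :=
  {v | (Function.update v y 0 ∈ D ∧ Function.update v y 1 ∈ D) ∨
    (Function.update v y 0 ∈ D ∧ Function.update v y 2 ∈ D) ∨
    (Function.update v y 1 ∈ D ∧ Function.update v y 2 ∈ D)}

-- At most one of the three votes can be negative, so two remain.
open Classical in
theorem mem_majority {y : G} {D : Set (G → ℝ)} {v : G → ℝ}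
    (h : {t | Function.update v y t ∉ D}.Subsingleton) : v ∈ majority y D := by
  by_contra hv
  simp only [majority, Set.mem_ofPred_eq, not_or, not_and_or] at hv
  have h01 : ¬ (Function.update v y 0 ∉ D ∧ Function.update v y 1 ∉ D) := fun hh => by
    simpa using h hh.1 hh.2
  have h02 : ¬ (Function.update v y 0 ∉ D ∧ Function.update v y 2 ∉ D) := fun hh => by
    simpa using h hh.1 hh.2
  have h12 : ¬ (Function.update v y 1 ∉ D ∧ Function.update v y 2 ∉ D) := fun hh => by
    simpa using h hh.1 hh.2
  tauto

open Classical in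
theorem notMem_majority {y : G} {D : Set (G → ℝ)} {v : G → ℝ}
    (h : {t | Function.update v y t ∈ D}.Subsingleton) : v ∉ majority y D := by
  rintro (hv | hv | hv) <;> simpa using h hv.1 hv.2

open Classical in
theorem update_mem_majority_self_iff (y : G) (D : Set (G → ℝ)) (v : G → ℝ) (t : ℝ) :
    Function.update v y t ∈ majority y D ↔ v ∈ majority y D := by
  simp [majority]

open Classical in
theorem LineTrivial.subsingleton_of_mem {D : Set (G → ℝ)} (hD : LineTrivial D) {y : G} {v : G → ℝ}
    (h : v ∈ majority y D) : {t | Function.update v y t ∉ D}.Subsingleton :=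
  (hD y v).resolve_left fun hs => notMem_majority hs h

open Classical in
theorem LineTrivial.subsingleton_of_notMem {D : Set (G → ℝ)} (hD : LineTrivial D) {y : G}
    {v : G → ℝ} (h : v ∉ majority y D) : {t | Function.update v y t ∈ D}.Subsingleton :=
  (hD y v).resolve_right fun hs => h (mem_majority hs)

theorem LineTrivial.majority {D : Set (G → ℝ)} (hD : LineTrivial D) (y : G) :
    LineTrivial (majority y D) := by
  classical
  intro i v
  by_cases hi : i = y
  · subst hi
    simp only [update_mem_majority_self_iff]
    by_cases hv : v ∈ SimonWolff.majority i D <;> simp [hv]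
  · by_contra! hcon
    obtain ⟨⟨a, ha, b, hb, hab⟩, c, hc, d, hd, hcd⟩ := hcon
    -- Suppose two points of the `i`-line are in the majority set and two are not. Each excludes at
    -- most one value of the coordinate `y`; at any other value `s`, all four agree with `D`, which
    -- contradicts triviality of `D` on an `i`-line.
    have hfin := (((hD.subsingleton_of_mem ha).finite.union (hD.subsingleton_of_mem hb).finite).union
      (hD.subsingleton_of_notMem hc).finite).union (hD.subsingleton_of_notMem hd).finite
    obtain ⟨s, hs⟩ := hfin.exists_notMem
    simp only [Set.mem_union, Set.mem_ofPred_eq, not_or, not_not,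
      Function.update_comm hi] at hs
    rcases hD i (Function.update v y s) with h | h
    · exact hab (h hs.1.1.1 hs.1.1.2)
    · exact hcd (h hs.1.2 hs.2)

theorem measurableSet_majority {D : Set (G → ℝ)} (hD : MeasurableSet D) (y : G) :
    MeasurableSet (majority y D) := by
  classical
  have hm : ∀ t : ℝ, MeasurableSet {v : G → ℝ | Function.update v y t ∈ D} := fun t => by
    refine (measurable_pi_iff.2 fun z => ?_ : Measurable fun v : G → ℝ => Function.update v y t) hD
    by_cases hz : z = y
    · subst hz
      simp
    · simpa [Function.update_of_ne hz] using measurable_pi_apply z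
  have h0 := hm 0
  have h1 := hm 1
  have h2 := hm 2
  exact (h0.inter h1).union ((h0.inter h2).union (h1.inter h2))

end Majority

/-! ### Sets not depending on given coordinates. -/

section Cylinder

variable {G Ω : Type*}

theorem measurableSet_sigmaOn_compl {V : G → Ω → ℝ} {D : Set (G → ℝ)} (hD : MeasurableSet D)
    {Λ : Set G} (h : ∀ v w : G → ℝ, (∀ z ∉ Λ, v z = w z) → (v ∈ D ↔ w ∈ D)) :
    MeasurableSet[sigmaOn V Λᶜ] {ω | (fun z => V z ω) ∈ D} := by
  classical
  -- Zeroing the coordinates in `Λ` does not affect membership in `D`.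
  have hm : Measurable[sigmaOn V Λᶜ] fun ω z => if z ∈ Λ then (0 : ℝ) else V z ω := by
    refine @measurable_pi_lambda _ _ _ (sigmaOn V Λᶜ) _ _ fun z => ?_
    by_cases hz : z ∈ Λ
    · simp only [hz, if_true]
      exact @measurable_const _ _ _ (sigmaOn V Λᶜ) _
    · simp only [hz, if_false]
      exact (comap_measurable (V z)).mono (le_iSup₂_of_le z hz le_rfl) le_rfl
  have he : {ω | (fun z => V z ω) ∈ D}
      = (fun ω z => if z ∈ Λ then (0 : ℝ) else V z ω) ⁻¹' D := by
    ext ω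
    exact h _ _ fun z hz => by simp [hz]
  rw [he]
  exact hm hD

end Cylinder

/-! ### The zero-one law. -/

section ZeroOne

variable {G Ω : Type*} [MeasurableSpace Ω]

open Classical in
/-- If the conditional laws are continuous, then a set of potentials which meets all lines in
direction `y` in at most one point has probability zero. -/
theorem measure_eq_zero_of_subsingleton (P : Measure Ω) [IsProbabilityMeasure P] {V : G → Ω → ℝ}
    (hV : ∀ x, Measurable (V x)) (hcont : HasContinuousConditionalLaws V P) (y : G)
    {N : Set (G → ℝ)} (hN : MeasurableSet N)
    (hs : ∀ v, {t | Function.update v y t ∈ N}.Subsingleton) :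
    P {ω | (fun z => V z ω) ∈ N} = 0 := by
  let glue : ({z : G // z ≠ y} → ℝ) × ℝ → G → ℝ := fun p z =>
    if h : z = y then p.2 else p.1 ⟨z, h⟩
  have hglue : Measurable glue := by
    refine measurable_pi_iff.2 fun z => ?_
    by_cases hz : z = y
    · simpa [glue, hz] using measurable_snd
    · have : (fun p => glue p z) = fun p => p.1 ⟨z, hz⟩ := by
        funext p
        simp [glue, hz]
      rw [this]
      exact (measurable_pi_apply _).comp measurable_fst
  let X : Ω → {z : G // z ≠ y} → ℝ := fun ω z => V z ω
  have hX : Measurable X := measurable_pi_iff.2 fun z => hV z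
  have hpre : {ω | (fun z => V z ω) ∈ N} = (fun ω => (X ω, V y ω)) ⁻¹' (glue ⁻¹' N) := by
    ext ω
    have : glue (X ω, V y ω) = fun z => V z ω := by
      funext z
      by_cases hz : z = y
      · subst hz
        simp [glue]
      · simp [glue, hz, X]
    simp only [Set.mem_ofPred_eq, Set.mem_preimage, this]
  have hS : MeasurableSet (glue ⁻¹' N) := hglue hN
  -- Disintegrate the joint law over the other coordinates; each fibre is empty or a single point,
  -- hence null.
  rw [hpre, ← Measure.map_apply (hX.prodMk (hV y)) hS,
    ← compProd_map_condDistrib (X := X) (hV y).aemeasurable, Measure.compProd_apply hS,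
    lintegral_map (Kernel.measurable_kernel_prodMk_left hS) hX]
  refine (lintegral_congr_ae ?_).trans lintegral_zero
  filter_upwards [hcont y] with ω hω
  have hsub : (Prod.mk (X ω) ⁻¹' (glue ⁻¹' N)).Subsingleton := by
    have hg : ∀ t, glue (X ω, t) = Function.update (fun z => V z ω) y t := fun t => by
      funext z
      by_cases hz : z = y
      · subst hz
        simp [glue]
      · simp [glue, hz, X]
    intro a ha b hb
    have hmem : ∀ t ∈ Prod.mk (X ω) ⁻¹' (glue ⁻¹' N),
        t ∈ {t | Function.update (fun z => V z ω) y t ∈ N} := fun t ht => by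
      rw [Set.mem_ofPred_eq, ← hg]
      exact ht
    exact hs _ (hmem a ha) (hmem b hb)
  rcases hsub.eq_empty_or_singleton with h | ⟨t, h⟩
  · simp [h]
  · simpa only [h] using hω t

/-- Each of the two differences of these sets meets every line in direction `y` in at most one
point. -/
theorem ae_mem_iff_mem_majority (P : Measure Ω) [IsProbabilityMeasure P] {V : G → Ω → ℝ}
    (hV : ∀ x, Measurable (V x)) (hcont : HasContinuousConditionalLaws V P) (y : G)
    {D : Set (G → ℝ)} (hD : MeasurableSet D) (hl : LineTrivial D) :
    ∀ᵐ ω ∂P, (fun z => V z ω) ∈ D ↔ (fun z => V z ω) ∈ majority y D := by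
  classical
  have hM := measurableSet_majority hD y
  have h1 := measure_eq_zero_of_subsingleton P hV hcont y (hD.diff hM) fun v => by
    by_cases hv : v ∈ majority y D
    · simp [update_mem_majority_self_iff, hv]
    · exact (hl.subsingleton_of_notMem hv).anti fun t ht => ht.1
  have h2 := measure_eq_zero_of_subsingleton P hV hcont y (hM.diff hD) fun v => by
    by_cases hv : v ∈ majority y D
    · exact (hl.subsingleton_of_mem hv).anti fun t ht => ht.2
    · simp [update_mem_majority_self_iff, hv]
  filter_upwards [measure_eq_zero_iff_ae_notMem.1 h1, measure_eq_zero_iff_ae_notMem.1 h2]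
    with ω hω1 hω2
  simp only [Set.mem_sdiff, not_and, not_not] at hω1 hω2
  exact ⟨hω1, hω2⟩

/-- The set obtained from `D` by taking the majority successively in the coordinates
`e 0, …, e (n - 1)`. -/
def iterMajority (e : ℕ → G) (D : Set (G → ℝ)) : ℕ → Set (G → ℝ)
  | 0 => D
  | n + 1 => majority (e n) (iterMajority e D n)

theorem measurableSet_iterMajority (e : ℕ → G) {D : Set (G → ℝ)} (hD : MeasurableSet D) (n : ℕ) :
    MeasurableSet (iterMajority e D n) := by
  induction n with
  | zero => exact hD
  | succ n ih => exact measurableSet_majority ih _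

theorem LineTrivial.iterMajority (e : ℕ → G) {D : Set (G → ℝ)} (hD : LineTrivial D) (n : ℕ) :
    LineTrivial (iterMajority e D n) := by
  induction n with
  | zero => exact hD
  | succ n ih => exact ih.majority _

open Classical in
theorem update_mem_majority_iff {D : Set (G → ℝ)} {i : G}
    (h : ∀ v t, Function.update v i t ∈ D ↔ v ∈ D) (y : G) (v : G → ℝ) (t : ℝ) :
    Function.update v i t ∈ majority y D ↔ v ∈ majority y D := by
  by_cases hi : i = y
  · subst hi
    exact update_mem_majority_self_iff i D v t
  · simp only [majority, Set.mem_ofPred_eq, Function.update_comm hi, h]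

open Classical in
theorem update_mem_iterMajority_iff (e : ℕ → G) (D : Set (G → ℝ)) {k n : ℕ} (hkn : k < n)
    (v : G → ℝ) (t : ℝ) :
    Function.update v (e k) t ∈ iterMajority e D n ↔ v ∈ iterMajority e D n := by
  induction n generalizing v t with
  | zero => omega
  | succ n ih =>
    rcases Nat.lt_succ_iff_lt_or_eq.1 hkn with h | rfl
    · exact update_mem_majority_iff (fun v t => ih h v t) _ v t
    · exact update_mem_majority_self_iff _ _ v t

open Classical in
theorem mem_iff_of_eqOn_compl {D : Set (G → ℝ)} (s : Finset G)
    (h : ∀ i ∈ s, ∀ v t, Function.update v i t ∈ D ↔ v ∈ D) {v w : G → ℝ}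
    (hvw : ∀ z ∉ s, v z = w z) : v ∈ D ↔ w ∈ D := by
  induction s using Finset.induction_on generalizing v with
  | empty => rw [funext fun z => hvw z (Finset.notMem_empty z)]
  | insert i s _ ih =>
    rw [← h i (Finset.mem_insert_self i s) v (w i)]
    refine ih (fun j hj => h j (Finset.mem_insert_of_mem hj)) fun z hz => ?_
    by_cases hzi : z = i
    · subst hzi
      rw [Function.update_self]
    · rw [Function.update_of_ne hzi]
      exact hvw z (by simp [hzi, hz])

/-- The event is the limsup of the iterated majorities. It ignores any initial segment of them, and
all later ones are independent of the coordinates in a given finite `Λ`. -/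
theorem exists_measurableAtInfinity_ae_eq [Countable G] [Nonempty G] (P : Measure Ω)
    [IsProbabilityMeasure P] {V : G → Ω → ℝ} (hV : ∀ x, Measurable (V x))
    (hcont : HasContinuousConditionalLaws V P) {D : Set (G → ℝ)} (hD : MeasurableSet D)
    (hl : LineTrivial D) :
    ∃ T : Set Ω, (∀ Λ : Set G, Λ.Finite → MeasurableSet[sigmaOn V Λᶜ] T) ∧
      ∀ᵐ ω ∂P, ω ∈ T ↔ (fun z => V z ω) ∈ D := by
  classical
  obtain ⟨e, he⟩ := exists_surjective_nat G
  refine ⟨{ω | ∀ m, ∃ n, (fun z => V z ω) ∈ iterMajority e D (n + m)}, fun Λ hΛ => ?_, ?_⟩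
  -- Each site `i` is voted out at stage `k i`, so from stage `m₀ + 1` on nothing depends on `Λ`.
  · choose k hk using he
    obtain ⟨m₀, hm₀⟩ := (hΛ.image k).bddAbove
    have hmeas : ∀ n, MeasurableSet[sigmaOn V Λᶜ]
        {ω | (fun z => V z ω) ∈ iterMajority e D (n + (m₀ + 1))} := fun n =>
      measurableSet_sigmaOn_compl (measurableSet_iterMajority e hD _) fun v w hvw =>
        mem_iff_of_eqOn_compl hΛ.toFinset (fun i hi v t => by
          have hlt : k i < n + (m₀ + 1) := by
            have := hm₀ (Set.mem_image_of_mem k (hΛ.mem_toFinset.1 hi))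
            omega
          have := update_mem_iterMajority_iff e D hlt v t
          rwa [hk] at this) (fun z hz => hvw z fun h => hz (hΛ.mem_toFinset.2 h))
    have hT : {ω | ∀ m, ∃ n, (fun z => V z ω) ∈ iterMajority e D (n + m)}
        = ⋂ m, ⋃ n, {ω | (fun z => V z ω) ∈ iterMajority e D ((n + m) + (m₀ + 1))} := by
      ext ω
      simp only [Set.mem_ofPred_eq, Set.mem_iInter, Set.mem_iUnion]
      constructor
      · intro h m
        obtain ⟨n, hn⟩ := h (m + (m₀ + 1))
        exact ⟨n, by rwa [add_assoc]⟩
      · intro h m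
        obtain ⟨n, hn⟩ := h m
        exact ⟨n + (m₀ + 1), by rwa [add_right_comm]⟩
    rw [hT]
    exact MeasurableSet.iInter fun m => MeasurableSet.iUnion fun n => hmeas (n + m)
  · have hn : ∀ᵐ ω ∂P, ∀ n, (fun z => V z ω) ∈ iterMajority e D n ↔
        (fun z => V z ω) ∈ iterMajority e D (n + 1) := ae_all_iff.2 fun n =>
      ae_mem_iff_mem_majority P hV hcont (e n) (measurableSet_iterMajority e hD n)
        (hl.iterMajority e n)
    filter_upwards [hn] with ω hω
    have hall : ∀ n, (fun z => V z ω) ∈ iterMajority e D n ↔ (fun z => V z ω) ∈ D := fun n => by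
      induction n with
      | zero => rfl
      | succ n ih => rw [← hω n, ih]
    simp [hall]

/-- The zero-one law for sets of potentials which are trivial on all coordinate lines. -/
theorem measure_eq_zero_or_one_of_lineTrivial [Countable G] [Nonempty G] (P : Measure Ω)
    [IsProbabilityMeasure P] {V : G → Ω → ℝ} (hV : ∀ x, Measurable (V x)) (hK : HasKProperty V P)
    (hcont : HasContinuousConditionalLaws V P) {D : Set (G → ℝ)} (hD : MeasurableSet D)
    (hl : LineTrivial D) :
    P {ω | (fun z => V z ω) ∈ D} = 0 ∨ P {ω | (fun z => V z ω) ∈ D} = 1 := by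
  classical
  obtain ⟨T, hT, hTD⟩ := exists_measurableAtInfinity_ae_eq P hV hcont hD hl
  obtain ⟨c, hc⟩ := hK (T.indicator fun _ => 1) fun Λ hΛ =>
    (@measurable_const ℝ Ω _ (sigmaOn V Λᶜ) 1).indicator (hT Λ hΛ)
  by_cases h1 : c = 1
  · right
    rw [← measure_univ (μ := P)]
    refine measure_congr (eventuallyEq_univ.2 ?_)
    filter_upwards [hc, hTD] with ω hω hωD
    refine hωD.1 (by_contra fun hmem => ?_)
    rw [Set.indicator_of_notMem hmem, h1] at hω
    exact zero_ne_one hω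
  · left
    rw [measure_eq_zero_iff_ae_notMem]
    filter_upwards [hc, hTD] with ω hω hωD hmem
    rw [Set.indicator_of_mem (hωD.2 hmem)] at hω
    exact h1 hω.symm

end ZeroOne

/-! ### Rank-one perturbation of the range condition. -/

section RankOne

variable {G : Type*}

/-- The set of potentials for which `δ_x` lies in the range of `A + V - E` is trivial on all
coordinate lines. -/
theorem lineTrivial_exists_solves (A : Ell2 G →L[ℂ] Ell2 G) (x : G) (E : ℂ) :
    LineTrivial {v : G → ℝ | ∃ ψ, Solves A v E (delta x) ψ} := by
  classical
  intro y v
  by_contra! hcon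
  obtain ⟨⟨a, ⟨ψ, hψ⟩, b, ⟨φ, hφ⟩, hab⟩, c, hc, d, hd, hcd⟩ := hcon
  have hmove : ∀ {s : ℝ} {ξ χ : Ell2 G}, Solves A (Function.update v y s) E ξ χ → ∀ t : ℝ,
      Solves A (Function.update v y t) E (ξ + (((t : ℂ) - s) * χ y) • delta y) χ := by
    intro s ξ χ h t
    have := h.update y t
    rwa [Function.update_idem, Function.update_self] at this
  have hab' : ((a : ℂ) - b) ≠ 0 := sub_ne_zero.2 (by exact_mod_cast hab)
  by_cases hφy : φ y = 0
  · have h := hmove hφ c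
    rw [hφy, mul_zero, zero_smul, add_zero] at h
    exact hc ⟨φ, h⟩
  -- On the operator at `a`, `φ - ψ` has image `(a - b) φ(y) δ_y`, so `δ_y` is in the range.
  obtain ⟨χ, hχ⟩ : ∃ χ, Solves A (Function.update v y a) E (delta y) χ := by
    have h := ((hmove hφ a).add_smul hψ (-1)).smul (((a : ℂ) - b) * φ y)⁻¹
    rw [neg_one_smul, neg_one_smul, add_neg_cancel_comm, inv_smul_smul₀ (mul_ne_zero hab' hφy)] at h
    exact ⟨_, h⟩
  -- At the value `t`, `χ` is mapped to `(1 + (t - a) χ(y)) δ_y`. If the factor is nonzero, a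
  -- multiple of `χ` corrects `ψ`. The factor is affine in `t` and equals 1 at `a`, so it has at
  -- most one zero.
  have key : ∀ t : ℝ, 1 + ((t : ℂ) - a) * χ y ≠ 0 →
      ∃ ξ, Solves A (Function.update v y t) E (delta x) ξ := by
    intro t ht
    have h1 : Solves A (Function.update v y t) E ((1 + ((t : ℂ) - a) * χ y) • delta y) χ := by
      rw [add_smul, one_smul]
      exact hmove hχ t
    have h2 := h1.smul (1 + ((t : ℂ) - a) * χ y)⁻¹
    rw [inv_smul_smul₀ ht] at h2
    have h3 := (hmove hψ t).add_smul h2 (-(((t : ℂ) - a) * ψ y))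
    rw [neg_smul, add_neg_cancel_right] at h3
    exact ⟨_, h3⟩
  have hc0 : 1 + ((c : ℂ) - a) * χ y = 0 := by
    by_contra h
    exact hc (key c h)
  have hd0 : 1 + ((d : ℂ) - a) * χ y = 0 := by
    by_contra h
    exact hd (key d h)
  have hcd' : ((c : ℂ) - d) * χ y = 0 := by linear_combination hc0 - hd0
  rcases mul_eq_zero.1 hcd' with h | h
  · exact hcd (by exact_mod_cast sub_eq_zero.1 h)
  · simp [h] at hc0

end RankOne

end SimonWolff

theorem theorem2p1 {G Ω : Type*} [Countable G] [MeasurableSpace Ω]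
    (P : Measure Ω) [IsProbabilityMeasure P]
    (A : SimonWolff.Ell2 G →L[ℂ] SimonWolff.Ell2 G) (hA : IsSelfAdjoint A)
    (V : G → Ω → ℝ) (hV : ∀ x, Measurable (V x))
    (hK : SimonWolff.HasKProperty V P)
    (hcont : SimonWolff.HasContinuousConditionalLaws V P)
    (x : G) :
    (∀ (ω : Ω) (E : ℝ),
      Tendsto (fun η : ℝ => SimonWolff.greenSqSum A (fun y => V y ω) x E η) (𝓝[>] 0)
        (𝓝 (SimonWolff.gammaFn A (fun y => V y ω) x E))) ∧
    (∀ E : ℝ, MeasurableSet {ω | SimonWolff.gammaFn A (fun y => V y ω) x E < ∞}) ∧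
    ∀ᵐ E : ℝ,
      P {ω | SimonWolff.gammaFn A (fun y => V y ω) x E < ∞} = 0 ∨
        P {ω | SimonWolff.gammaFn A (fun y => V y ω) x E < ∞} = 1 := by
  have hmem : ∀ (ω : Ω) (E : ℝ), SimonWolff.gammaFn A (fun y => V y ω) x E < ∞ ↔
      (fun y => V y ω) ∈ {v : G → ℝ | ∃ ψ, SimonWolff.Solves A v E (SimonWolff.delta x) ψ} :=
    fun ω E => SimonWolff.gammaFn_lt_top_iff hA _ x E
  have hVm : Measurable fun ω y => V y ω := measurable_pi_iff.2 hV
  refine ⟨fun ω E => SimonWolff.tendsto_greenSqSum hA _ x E,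
    fun E => measurableSet_lt ((SimonWolff.measurable_gammaFn hA x E).comp hVm) measurable_const,
    Eventually.of_forall fun E => ?_⟩
  have : Nonempty G := ⟨x⟩
  have hD : MeasurableSet {v : G → ℝ | ∃ ψ, SimonWolff.Solves A v E (SimonWolff.delta x) ψ} := by
    simp only [← SimonWolff.gammaFn_lt_top_iff hA]
    exact measurableSet_lt (SimonWolff.measurable_gammaFn hA x E) measurable_const
  simp only [hmem]
  exact SimonWolff.measure_eq_zero_or_one_of_lineTrivial P hV hK hcont hD
    (SimonWolff.lineTrivial_exists_solves A x E)
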